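/- Let $d\ge 1$ and $n_1,\dots,n_d\ge 2$ be integers, and let $G=G_{(n_1,\dots,n_d)}$ be the $d$-dimensional unweighted grid graph: its nodes are the integer vectors $\mathbf{x}=[x_1,\dots,x_d]$ with $1\le x_j\le n_j$, and two nodes are adjacent iff they differ in exactly one coordinate, and there by exactly $1$. Assume that $G$ has no inner node, i.e. no node has two neighbours in every dimension (equivalently, $n_i=2$ for some $i$). Let $S$ be the adjacency matrix of $G$, $D$ its diagonal degree matrix, and $\mathfrak{L}=D^{-1/2}(D-S)D^{-1/2}$ its normalized Laplacian. For an integer vector $\mathbf{z}=[z_1,\dots,z_d]$ with $0\le z_j\le n_j-1$ consider the following system of $d+1$ equations in the real unknowns $\lambda$ and $\boldsymbol\delta=(\delta_1,\dots,\delta_d)$, where $\cos\delta_l\neq 0$ for all $l$ (so that the tangents are defined): $$2d\,\lambda=\sum_{j=1}^d\left(2+2\cos\left(\frac{z_j\pi-2\delta_j}{n_j-1}\right)\right),$$ $$\lambda=1+\cos\left(\frac{z_l\pi-2\delta_l}{n_l-1}\right)+\tan(\delta_l)\,\sin\left(\frac{z_l\pi-2\delta_l}{n_l-1}\right)\qquad(l=1,\dots,d).$$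 Then: (1) For every $\mathbf{z}$ the system has a solution $(\lambda,\boldsymbol\delta)$ with $|\delta_j|<\pi/2$ for all $j$. (2) For every $\mathbf{z}$ and every real solution $(\lambda,\boldsymbol\delta)$ of the system, $$\lambda=\lambda_{\mathbf z}=1+\frac1d\sum_{j=1}^d\cos\left(\frac{1}{n_j-1}\left(z_j\pi-2\delta_j\right)\right)$$ is an eigenvalue of $\mathfrak{L}$, and the vector $\mathbf{v}_{\mathbf z}$ with components $$\nu_{\mathbf z,\mathbf x}=D_{\mathbf x,\mathbf x}^{1/2}\prod_{j=1}^d(-1)^{x_j}\cos\left(\frac{x_j-1}{n_j-1}\left(z_j\pi-2\delta_j\right)+\delta_j\right)$$ is a (nonzero) eigenvector of $\mathfrak{L}$ for it. (3) These are all eigenvalues and eigenvectors: if for each $\mathbf z$ a solution $(\lambda_{\mathbf z},\boldsymbol\delta^{\mathbf z})$ with $|\delta^{\mathbf z}_j|<\pi/2$ for all $j$ is chosen, then the vectors $\mathbf v_{\mathbf z}$ are pairwise orthogonal and span the space of all real vectors indexed by the nodes of $G$, and the eigenvalues of $\mathfrak{L}$ are exactly the numbers $\lambda_{\mathbf z}$.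 -/

import Mathlib

noncomputable section

/-- Node identity vectors of the grid with `n j` layers in dimension `j`. The `j`-th coordinate is
stored 0-based: the 1-based coordinate `x_j` is `(x j : ℕ) + 1`. The same type serves for the eigen
identity vectors `z` with `0 ≤ z_j < n_j` (no shift there). -/
abbrev GridNode {d : ℕ} (n : Fin d → ℕ) : Type := (j : Fin d) → Fin (n j)

/-- The unweighted grid graph: the Cartesian product of the path graphs on `n j` vertices. Two nodes
are adjacent when they are neighbours on the path in one dimension and agree in all others. -/
def gridGraph {d : ℕ} (n : Fin d → ℕ) : SimpleGraph (GridNode n) where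
  Adj x y := ∃ j, (SimpleGraph.pathGraph (n j)).Adj (x j) (y j) ∧ ∀ i, i ≠ j → x i = y i
  symm := ⟨fun _ _ ⟨j, h, e⟩ => ⟨j, h.symm, fun i hi => (e i hi).symm⟩⟩
  loopless := ⟨fun _ ⟨_, h, _⟩ => h.ne rfl⟩

instance {d : ℕ} (n : Fin d → ℕ) : DecidableRel (gridGraph n).Adj := Classical.decRel _

/-- An inner node has two neighbours in the grid in each dimension. -/
def IsInnerNode {d : ℕ} (n : Fin d → ℕ) (x : GridNode n) : Prop :=
  ∀ j, ∃ a b : Fin (n j), a ≠ b ∧ (gridGraph n).Adj x (Function.update x j a) ∧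
    (gridGraph n).Adj x (Function.update x j b)

/-- The normalized Laplacian `D^{-1/2} (D - S) D^{-1/2}` of a graph. -/
def normalizedLaplacian {V : Type*} [Fintype V] [DecidableEq V] (G : SimpleGraph V)
    [DecidableRel G.Adj] : Matrix V V ℝ :=
  Matrix.diagonal (fun v => (√(G.degree v : ℝ))⁻¹) * G.lapMatrix ℝ *
    Matrix.diagonal (fun v => (√(G.degree v : ℝ))⁻¹)

/-- The angle `(z_j π - 2 δ_j) / (n_j - 1)`. -/
def gridAngle {d : ℕ} (n : Fin d → ℕ) (z : GridNode n) (δ : Fin d → ℝ) (j : Fin d) : ℝ :=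
  1 / ((n j : ℝ) - 1) * (((z j : ℕ) : ℝ) * Real.pi - 2 * δ j)

/-- `(lam, δ)` solves the system that defines the eigenvalue and the shifts for the index `z`:
`2 d lam = ∑_j (2 + 2 cos θ_j)`, and `lam = 1 + cos θ_l + tan δ_l sin θ_l` for every `l`, where
`θ_j = (z_j π - 2 δ_j) / (n_j - 1)`. The condition `cos δ_l ≠ 0` says that the tangents in
these equations are defined. -/
structure IsShiftSolution {d : ℕ} (n : Fin d → ℕ) (z : GridNode n) (lam : ℝ) (δ : Fin d → ℝ) :
    Prop where
  sum_eq : 2 * (d : ℝ) * lam = ∑ j, (2 + 2 * Real.cos (gridAngle n z δ j))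
  cos_ne_zero : ∀ l, Real.cos (δ l) ≠ 0
  eq_at : ∀ l, lam = 1 + Real.cos (gridAngle n z δ l) +
    Real.tan (δ l) * Real.sin (gridAngle n z δ l)

/-- `1 + (1/d) ∑_j cos((z_j π - 2 δ_j) / (n_j - 1))`. -/
def gridEigenvalue {d : ℕ} (n : Fin d → ℕ) (z : GridNode n) (δ : Fin d → ℝ) : ℝ :=
  1 + 1 / (d : ℝ) * ∑ j, Real.cos (gridAngle n z δ j)

/-- The vector with components
`√(D_{x,x}) ∏_j (-1)^{x_j} cos((x_j - 1) / (n_j - 1) * (z_j π - 2 δ_j) + δ_j)`, `x_j` 1-based. -/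
def gridEigenvector {d : ℕ} (n : Fin d → ℕ) (z : GridNode n) (δ : Fin d → ℝ) (x : GridNode n) : ℝ :=
  √((gridGraph n).degree x : ℝ) *
    ∏ j, (-1 : ℝ) ^ ((x j : ℕ) + 1) *
      Real.cos (((x j : ℕ) : ℝ) / ((n j : ℝ) - 1) * (((z j : ℕ) : ℝ) * Real.pi - 2 * δ j) + δ j)

end

/-!
Write `m = λ - 1`, `N = n_j - 1` and `θ_j = (z_j π - 2 δ_j) / N`, and count coordinates from `0`.

*Eigenpairs.* On a single path, the wave `g k = (-1) ^ (k + 1) cos (k θ + δ)` satisfies the interior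
recurrence `g (k + 1) + g (k - 1) = -2 cos θ g k` everywhere, and `cos (θ - δ) = m cos δ` together
with `N θ + 2 δ = z π` says that its continuation by one node beyond either end is `-m` times its
value at that end (`pathSum_wave`). The number of missing neighbours is `2 - deg`, so in the product
of the waves over all dimensions the boundary terms add up to `m (2 d - deg)`. As `∑ cos θ_j = d m`,
the neighbour sum is `-m deg` times the function: an eigenfunction of the random walk, which becomes
an eigenvector of the normalized Laplacian on multiplication by `√deg`
(`normalizedLaplacian_mulVec`).

*Solvability.* Fix `m ∈ [-1, 1]`. For `0 < θ < π` the equation of one path determines `δ = arctan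
((m - cos θ) / sin θ)`, and `N θ + 2 δ = z π` can be solved by the intermediate value theorem
(`exists_isPhase`). The left side increases in `θ` and in `m`, so the solution is unique and `cos θ`
grows with `m` (`IsPhase.antitone`). Hence the average of the `cos θ_j` is a monotone self-map of
the complete lattice `[-1, 1]`, and the Knaster-Tarski theorem gives a fixed point, that is, a
solution of the system (`exists_isPhase_average_eq`).

*Completeness.* Eigenvectors with different eigenvalues are orthogonal since the matrix is
symmetric. With equal eigenvalues the parameter `m` is shared, so waves with different `z_j` have
different frequencies (`cos_ne_cos_of_index_ne`) and are orthogonal on their path, as eigenvectors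
of one symmetric tridiagonal matrix. The indices cannot differ in just one dimension, because equal
`z_j` have equal frequencies (`cos_eq_of_index_eq`) and `∑ cos θ_j = d m` for both. The inner
product of the eigenvectors is a sum over the dimensions `k` of products of path inner products, of
which only the `k`-th is weighted, so each summand has a vanishing factor
(`IsShiftSolution.dotProduct_eq_zero`). A full set of nonzero pairwise orthogonal eigenvectors then
spans and exhausts the spectrum.
-/

/-! ### Waves on a path -/

open scoped Classical in
/-- The sum of `f` over the neighbours of `x` in the path graph. -/
noncomputable def pathSum {n : ℕ} (x : Fin n) (f : Fin n → ℝ) : ℝ :=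
  ∑ a, if (SimpleGraph.pathGraph n).Adj x a then f a else 0

lemma pathSum_eq {n : ℕ} (x : Fin n) (g : ℕ → ℝ) :
    pathSum x (fun a => g a) =
      (if (x : ℕ) + 1 < n then g (x + 1) else 0) + (if 0 < (x : ℕ) then g (x - 1) else 0) := by
  classical
  have hsplit : ∀ a : Fin n, (if (SimpleGraph.pathGraph n).Adj x a then g a else 0) =
      (if (x : ℕ) + 1 = a then g a else 0) + (if (a : ℕ) + 1 = x then g a else 0) := by
    intro a
    rw [SimpleGraph.pathGraph_adj]
    by_cases h1 : (x : ℕ) + 1 = a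
    · have h2 : ¬ (a : ℕ) + 1 = x := by omega
      simp [h1, h2]
    · simp [h1]
  rw [pathSum, Finset.sum_congr rfl fun a _ => hsplit a, Finset.sum_add_distrib]
  congr 1
  · split_ifs with h
    · rw [Finset.sum_eq_single (⟨x + 1, h⟩ : Fin n)]
      · simp
      · intro b _ hb
        rw [if_neg]
        intro h'
        exact hb (Fin.ext h'.symm)
      · simp
    · refine Finset.sum_eq_zero fun a _ => if_neg ?_
      have := a.isLt
      omega
  · split_ifs with h
    · rw [Finset.sum_eq_single (⟨x - 1, by have := x.isLt; omega⟩ : Fin n)]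
      · rw [if_pos]
        simp only
        omega
      · intro b _ hb
        rw [if_neg]
        intro h'
        exact hb (Fin.ext (by simp only; omega))
      · simp
    · exact Finset.sum_eq_zero fun a _ => if_neg (by omega)

/-- The degree of `x` in the path graph, as a real number. -/
noncomputable def pathDegree {n : ℕ} (x : Fin n) : ℝ := pathSum x fun _ => 1

lemma pathDegree_eq {n : ℕ} (x : Fin n) :
    pathDegree x = (if (x : ℕ) + 1 < n then 1 else 0) + (if 0 < (x : ℕ) then 1 else 0) :=
  pathSum_eq x fun _ => 1

/-- The neighbour sum of an alternating cosine wave along a path. -/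
lemma pathSum_wave {n z : ℕ} (x : Fin n) {m θ δ : ℝ}
    (hθ : ((n : ℝ) - 1) * θ + 2 * δ = z * Real.pi)
    (hm : Real.cos (θ - δ) = m * Real.cos δ) :
    pathSum x (fun a => (-1 : ℝ) ^ ((a : ℕ) + 1) * Real.cos ((a : ℕ) * θ + δ)) =
      (-2 * Real.cos θ + m * (2 - pathDegree x)) *
        ((-1 : ℝ) ^ ((x : ℕ) + 1) * Real.cos ((x : ℕ) * θ + δ)) := by
  rw [pathSum_eq x fun k => (-1 : ℝ) ^ (k + 1) * Real.cos (k * θ + δ), pathDegree_eq]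
  have hlt := x.isLt
  generalize (x : ℕ) = k at *
  have hsum : Real.cos (((k : ℝ) + 1) * θ + δ) + Real.cos (((k : ℝ) - 1) * θ + δ) =
      2 * Real.cos θ * Real.cos (k * θ + δ) := by
    rw [show ((k : ℝ) + 1) * θ + δ = (k * θ + δ) + θ by ring,
      show ((k : ℝ) - 1) * θ + δ = (k * θ + δ) - θ by ring, Real.cos_add, Real.cos_sub]
    ring
  -- the wave continued to `k + 1` and `k - 1`; a continued value outside the path is
  -- `-m` times the value at the end
  have hup : (if k + 1 < n then (-1 : ℝ) ^ (k + 1 + 1) * Real.cos ((k + 1 : ℕ) * θ + δ) else 0) =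
      (-1 : ℝ) ^ k * Real.cos (((k : ℝ) + 1) * θ + δ) -
      (1 - (if k + 1 < n then 1 else 0)) * m * ((-1 : ℝ) ^ k * Real.cos (k * θ + δ)) := by
    split_ifs with h
    · push_cast
      ring
    · have hn : (n : ℝ) = k + 1 := by
        have : n = k + 1 := by omega
        rw [this]; push_cast; ring
      have h1 : (k : ℝ) * θ + δ = z * Real.pi - δ := by rw [← hθ, hn]; ring
      have h2 : ((k : ℝ) + 1) * θ + δ = (θ - δ) + z * Real.pi := by rw [← hθ, hn]; ring
      rw [h1, h2, Real.cos_add_nat_mul_pi, Real.cos_nat_mul_pi_sub, hm]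
      ring
  have hdown : (if 0 < k then (-1 : ℝ) ^ (k - 1 + 1) * Real.cos ((k - 1 : ℕ) * θ + δ) else 0) =
      (-1 : ℝ) ^ k * Real.cos (((k : ℝ) - 1) * θ + δ) -
      (1 - (if 0 < k then 1 else 0)) * m * ((-1 : ℝ) ^ k * Real.cos (k * θ + δ)) := by
    split_ifs with h
    · obtain ⟨l, rfl⟩ : ∃ l, k = l + 1 := ⟨k - 1, by omega⟩
      simp
    · obtain rfl : k = 0 := by omega
      have : Real.cos (-θ + δ) = m * Real.cos δ := by
        rw [← hm, ← Real.cos_neg (θ - δ)]; ring_nf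
      simp [this]
  rw [hup, hdown]
  linear_combination (-1 : ℝ) ^ k * hsum

/-- Neighbour sums along a path form a symmetric operator. -/
lemma sum_mul_pathSum_comm {n : ℕ} (g h : Fin n → ℝ) :
    ∑ x, h x * pathSum x g = ∑ x, g x * pathSum x h := by
  classical
  simp only [pathSum, Finset.mul_sum]
  rw [Finset.sum_comm]
  refine Finset.sum_congr rfl fun x _ => Finset.sum_congr rfl fun y _ => ?_
  simp only [SimpleGraph.adj_comm _ y x]
  split_ifs <;> ring

/-- Two waves with the same boundary parameter `m` and different frequencies are orthogonal. -/
lemma sum_wave_mul_wave {n z z' : ℕ} {m θ δ θ' δ' : ℝ}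
    (hθ : ((n : ℝ) - 1) * θ + 2 * δ = z * Real.pi) (hm : Real.cos (θ - δ) = m * Real.cos δ)
    (hθ' : ((n : ℝ) - 1) * θ' + 2 * δ' = z' * Real.pi) (hm' : Real.cos (θ' - δ') = m * Real.cos δ')
    (hne : Real.cos θ ≠ Real.cos θ') :
    ∑ x : Fin n, ((-1 : ℝ) ^ ((x : ℕ) + 1) * Real.cos ((x : ℕ) * θ + δ)) *
      ((-1 : ℝ) ^ ((x : ℕ) + 1) * Real.cos ((x : ℕ) * θ' + δ')) = 0 := by
  have key := sum_mul_pathSum_comm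
    (fun a : Fin n => (-1 : ℝ) ^ ((a : ℕ) + 1) * Real.cos ((a : ℕ) * θ + δ))
    (fun a : Fin n => (-1 : ℝ) ^ ((a : ℕ) + 1) * Real.cos ((a : ℕ) * θ' + δ'))
  simp only [pathSum_wave _ hθ hm, pathSum_wave _ hθ' hm'] at key
  rw [← sub_eq_zero, ← Finset.sum_sub_distrib] at key
  have h2 : -2 * (Real.cos θ - Real.cos θ') ≠ 0 := mul_ne_zero (by norm_num) (sub_ne_zero.2 hne)
  refine (mul_eq_zero.1 ?_).resolve_left h2
  rw [← key, Finset.mul_sum]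
  exact Finset.sum_congr rfl fun x _ => by ring

/-! ### Neighbour sums and degrees in the grid -/

/-- A neighbour sum in the grid splits into neighbour sums along the coordinate lines. -/
lemma sum_gridGraph_adj {d : ℕ} (n : Fin d → ℕ) (x : GridNode n) (F : GridNode n → ℝ) :
    (∑ y, if (gridGraph n).Adj x y then F y else 0) =
      ∑ j, pathSum (x j) fun a => F (Function.update x j a) := by
  classical
  have hpt : ∀ y, (if (gridGraph n).Adj x y then F y else 0) =
      ∑ j, ∑ a, if (SimpleGraph.pathGraph (n j)).Adj (x j) a then
        (if y = Function.update x j a then F (Function.update x j a) else 0) else 0 := by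
    intro y
    split_ifs with h
    · obtain ⟨j, hj, hy⟩ := h
      have hyx : y = Function.update x j (y j) := by
        ext i
        by_cases hi : i = j
        · subst hi; simp
        · simp [hi, hy i hi]
      rw [Finset.sum_eq_single j, Finset.sum_eq_single (y j)]
      · rw [if_pos hj, if_pos hyx, ← hyx]
      · intro a _ ha
        have : y ≠ Function.update x j a := fun h => ha (by rw [h]; simp)
        simp [this]
      · simp
      · intro i _ hi
        refine Finset.sum_eq_zero fun a _ => ?_
        have : y ≠ Function.update x i a := fun h => by
          rw [h, Function.update_of_ne hi.symm] at hj
          exact hj.ne rfl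
        simp [this]
      · simp
    · refine (Finset.sum_eq_zero fun j _ => Finset.sum_eq_zero fun a _ => ?_).symm
      split_ifs with h1 h2
      · refine absurd ⟨j, ?_, fun i hi => ?_⟩ h
        · simpa [h2] using h1
        · simp [h2, hi]
      · rfl
      · rfl
  simp only [hpt, pathSum]
  rw [Finset.sum_comm]
  refine Finset.sum_congr rfl fun j _ => ?_
  rw [Finset.sum_comm]
  refine Finset.sum_congr rfl fun a _ => ?_
  split_ifs <;> simp

lemma gridGraph_degree {d : ℕ} (n : Fin d → ℕ) (x : GridNode n) :
    ((gridGraph n).degree x : ℝ) = ∑ j, pathDegree (x j) := by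
  have := sum_gridGraph_adj n x fun _ => 1
  unfold pathDegree
  rw [← this, ← SimpleGraph.card_neighborFinset_eq_degree, SimpleGraph.neighborFinset_eq_filter]
  simp

lemma pathDegree_pos {n : ℕ} (hn : 2 ≤ n) (x : Fin n) : 0 < pathDegree x := by
  rw [pathDegree_eq]
  by_cases h : (x : ℕ) + 1 < n
  · rw [if_pos h]
    positivity
  · rw [if_neg h, if_pos (by omega)]
    norm_num

lemma gridGraph_degree_pos {d : ℕ} (hd : 0 < d) {n : Fin d → ℕ} (hn : ∀ j, 2 ≤ n j)
    (x : GridNode n) : 0 < ((gridGraph n).degree x : ℝ) := by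
  rw [gridGraph_degree]
  exact Finset.sum_pos (fun j _ => pathDegree_pos (hn j) _) ⟨⟨0, hd⟩, Finset.mem_univ _⟩

/-! ### The normalized Laplacian and orthogonal families of eigenvectors -/

section

open scoped Matrix

variable {V : Type*} [Fintype V] [DecidableEq V]

lemma normalizedLaplacian_isSymm (G : SimpleGraph V) [DecidableRel G.Adj] :
    (normalizedLaplacian G).IsSymm := by
  unfold normalizedLaplacian Matrix.IsSymm
  rw [Matrix.transpose_mul, Matrix.transpose_mul, Matrix.diagonal_transpose,
    (SimpleGraph.isSymm_lapMatrix ℝ G).eq, Matrix.mul_assoc]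

/-- Multiplication by `√deg` carries eigenfunctions of the random walk `D⁻¹ S` to eigenvectors of
the normalized Laplacian. -/
lemma normalizedLaplacian_mulVec (G : SimpleGraph V) [DecidableRel G.Adj] {f : V → ℝ} {t : ℝ}
    (hdeg : ∀ x, 0 < (G.degree x : ℝ))
    (hf : ∀ x, (∑ y, if G.Adj x y then f y else 0) = (1 - t) * G.degree x * f x) :
    normalizedLaplacian G *ᵥ (fun x => √(G.degree x : ℝ) * f x) =
      t • fun x => √(G.degree x : ℝ) * f x := by
  unfold normalizedLaplacian
  rw [← Matrix.mulVec_mulVec, ← Matrix.mulVec_mulVec]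
  have h1 : (Matrix.diagonal fun v => (√(G.degree v : ℝ))⁻¹) *ᵥ
      (fun x => √(G.degree x : ℝ) * f x) = f := by
    ext x
    rw [Matrix.mulVec_diagonal, inv_mul_cancel_left₀ (Real.sqrt_pos.2 (hdeg x)).ne']
  rw [h1]
  ext x
  rw [Matrix.mulVec_diagonal, SimpleGraph.lapMatrix_mulVec_apply]
  have h2 : ∑ u ∈ G.neighborFinset x, f u = (1 - t) * G.degree x * f x := by
    rw [← hf x, SimpleGraph.neighborFinset_eq_filter, Finset.sum_filter]
  have h3 := Real.mul_self_sqrt (hdeg x).le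
  have h4 := (Real.sqrt_pos.2 (hdeg x)).ne'
  rw [h2, Pi.smul_apply, smul_eq_mul]
  nth_rewrite 2 3 [← h3]
  field_simp
  ring

omit [DecidableEq V] in
lemma dotProduct_mulVec_comm_of_isSymm {M : Matrix V V ℝ} (hM : M.IsSymm) (v w : V → ℝ) :
    v ⬝ᵥ M *ᵥ w = M *ᵥ v ⬝ᵥ w := by
  rw [Matrix.dotProduct_mulVec, ← Matrix.mulVec_transpose, hM.eq]

omit [DecidableEq V] in
lemma dotProduct_eq_zero_of_eigenvalue_ne {M : Matrix V V ℝ} (hM : M.IsSymm) {v w : V → ℝ}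
    {s t : ℝ} (hv : M *ᵥ v = s • v) (hw : M *ᵥ w = t • w) (hst : s ≠ t) : v ⬝ᵥ w = 0 := by
  have h := dotProduct_mulVec_comm_of_isSymm hM v w
  rw [hv, hw, dotProduct_smul, smul_dotProduct, smul_eq_mul, smul_eq_mul] at h
  have h2 : (s - t) * (v ⬝ᵥ w) = 0 := by linear_combination -h
  exact (mul_eq_zero.1 h2).resolve_left (sub_ne_zero.2 hst)

omit [DecidableEq V] in
lemma span_eq_top_of_pairwise_dotProduct_eq_zero {v : V → V → ℝ} (h0 : ∀ z, v z ≠ 0)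
    (horth : ∀ z z', z ≠ z' → v z ⬝ᵥ v z' = 0) : Submodule.span ℝ (Set.range v) = ⊤ := by
  refine LinearIndependent.span_eq_top_of_card_eq_finrank' ?_ (by simp)
  rw [Fintype.linearIndependent_iff]
  intro c hc z
  have h : (∑ i, c i • v i) ⬝ᵥ v z = 0 := by rw [hc, zero_dotProduct]
  rw [sum_dotProduct, Finset.sum_eq_single z] at h
  · rw [smul_dotProduct, smul_eq_mul] at h
    exact (mul_eq_zero.1 h).resolve_right fun h' => h0 z (dotProduct_self_eq_zero.1 h')
  · intro i _ hi
    rw [smul_dotProduct, horth i z hi, smul_zero]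
  · simp

lemma hasEigenvalue_iff_of_span_eigenvectors_eq_top {M : Matrix V V ℝ} (hM : M.IsSymm)
    {ι : Type*} {v : ι → V → ℝ} {μ : ι → ℝ}
    (hv : ∀ z, Module.End.HasEigenvector (Matrix.toLin' M) (μ z) (v z))
    (hspan : Submodule.span ℝ (Set.range v) = ⊤) (t : ℝ) :
    Module.End.HasEigenvalue (Matrix.toLin' M) t ↔ ∃ z, t = μ z := by
  constructor
  · intro ht
    by_contra! hne
    obtain ⟨w, hw⟩ := ht.exists_hasEigenvector
    refine hw.2 (dotProduct_self_eq_zero.1 ?_)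
    have hall : ∀ u ∈ Submodule.span ℝ (Set.range v), w ⬝ᵥ u = 0 := by
      intro u hu
      induction hu using Submodule.span_induction with
      | mem u hu =>
        obtain ⟨z, rfl⟩ := hu
        have hw1 := hw.apply_eq_smul
        have hv1 := (hv z).apply_eq_smul
        rw [Matrix.toLin'_apply] at hw1 hv1
        exact dotProduct_eq_zero_of_eigenvalue_ne hM hw1 hv1 (hne z)
      | zero => exact dotProduct_zero _
      | add a b _ _ ha hb => rw [dotProduct_add, ha, hb, add_zero]
      | smul c a _ ha => rw [dotProduct_smul, ha, smul_zero]
    exact hall w (hspan ▸ Submodule.mem_top)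
  · rintro ⟨z, rfl⟩
    exact Module.End.hasEigenvalue_of_hasEigenvector (hv z)

end

/-! ### The equation of one path -/

open Real in
/-- The angle `θ ∈ [0, π]` and the shift `|δ| < π / 2` solve the equation of one path with `N` edges
and index `z`, for the boundary parameter `m = λ - 1`. The relation `θ = (z π - 2 δ) / N` is stated
without division. -/
structure IsPhase (N z : ℕ) (m θ δ : ℝ) : Prop where
  nonneg : 0 ≤ θ
  le_pi : θ ≤ π
  abs_delta_lt : |δ| < π / 2
  angle_eq : N * θ + 2 * δ = z * π
  eq : m = cos θ + tan δ * sin θ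

open Real in
/-- The inequality behind the monotonicity of `θ ↦ (m - cos θ) / sin θ` for `|m| ≤ 1`. -/
lemma mul_sin_sub_sin_le_sin_sub {m θ θ' : ℝ} (h0 : 0 ≤ θ) (hle : θ ≤ θ') (hpi : θ' ≤ π)
    (hm : |m| ≤ 1) : m * (sin θ' - sin θ) ≤ sin (θ' - θ) := by
  set a := (θ' - θ) / 2 with ha
  set s := (θ' + θ) / 2 with hs
  have hsin : 0 ≤ sin a := sin_nonneg_of_nonneg_of_le_pi (by linarith) (by linarith)
  have hcos : |cos s| ≤ cos a := by
    refine abs_le'.2 ⟨cos_le_cos_of_nonneg_of_le_pi (by linarith) (by linarith) (by linarith), ?_⟩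
    rw [← cos_pi_sub]
    exact cos_le_cos_of_nonneg_of_le_pi (by linarith) (by linarith) (by linarith)
  have hmc : m * cos s ≤ cos a := by
    calc m * cos s ≤ |m| * |cos s| := by rw [← abs_mul]; exact le_abs_self _
      _ ≤ 1 * |cos s| := by gcongr
      _ ≤ cos a := by rwa [one_mul]
  rw [sin_sub_sin, show θ' - θ = 2 * a by rw [ha]; ring, sin_two_mul,
    show 2 * a / 2 = a by ring]
  nlinarith [mul_le_mul_of_nonneg_left hmc hsin]

lemma IsPhase.index_eq_zero {N z : ℕ} {m δ : ℝ} (h : IsPhase N z m 0 δ) : z = 0 := by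
  have h1 := h.angle_eq
  have h2 := abs_lt.1 h.abs_delta_lt
  have h3 : (z : ℝ) < 1 := by nlinarith [Real.pi_pos]
  have h4 : z < 1 := by exact_mod_cast h3
  omega

lemma IsPhase.index_eq_of_pi {N z : ℕ} {m δ : ℝ} (h : IsPhase N z m Real.pi δ) : z = N := by
  have h1 := h.angle_eq
  have h2 := abs_lt.1 h.abs_delta_lt
  have h3 : (z : ℝ) < N + 1 := by nlinarith [Real.pi_pos]
  have h4 : (N : ℝ) < z + 1 := by nlinarith [Real.pi_pos]
  have h5 : z < N + 1 := by exact_mod_cast h3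
  have h6 : N < z + 1 := by exact_mod_cast h4
  omega

open Real in
/-- The phase of a path decreases as the boundary parameter grows, so that its cosine increases.
For `0 < θ < π` the shift is `arctan ((m - cos θ) / sin θ)`, which increases with `m` and `θ`;
at the ends of the interval both sides are determined. -/
lemma IsPhase.antitone {N z : ℕ} (hN : 1 ≤ N) {m m' θ θ' δ δ' : ℝ} (h : IsPhase N z m θ δ)
    (h' : IsPhase N z m' θ' δ') (hm' : m' ≤ 1) (hm : -1 ≤ m) (hmm : m ≤ m') : θ' ≤ θ := by
  by_contra! hlt
  have hN' : (1 : ℝ) ≤ N := by exact_mod_cast hN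
  have hδ : δ' < δ := by
    have := h.angle_eq; have := h'.angle_eq
    nlinarith
  have htan : tan δ' < tan δ :=
    tan_lt_tan_of_lt_of_lt_pi_div_two (abs_lt.1 h'.abs_delta_lt).1 (abs_lt.1 h.abs_delta_lt).2 hδ
  have h1 := h.eq
  have h2 := h'.eq
  rcases h.nonneg.eq_or_lt with h0 | h0
  · subst h0
    have hz := h.index_eq_zero
    have hδ0 : δ = 0 := by
      have := h.angle_eq
      rw [hz] at this
      push_cast at this
      linarith
    rw [hδ0, tan_zero] at htan
    rw [cos_zero, sin_zero, mul_zero] at h1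
    have hc : cos θ' < 1 := by
      rw [← cos_zero]
      exact cos_lt_cos_of_nonneg_of_le_pi le_rfl h'.le_pi hlt
    have hs : 0 ≤ sin θ' := sin_nonneg_of_nonneg_of_le_pi h'.nonneg h'.le_pi
    nlinarith
  rcases h'.le_pi.eq_or_lt with hp | hp
  · subst hp
    have hz := h'.index_eq_of_pi
    have hδ0 : δ' = 0 := by
      have := h'.angle_eq
      rw [hz] at this
      linarith
    rw [hδ0, tan_zero] at htan
    rw [cos_pi, sin_pi, mul_zero] at h2
    have hc : -1 < cos θ := by
      rw [← cos_pi]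
      exact cos_lt_cos_of_nonneg_of_le_pi h.nonneg le_rfl hlt
    have hs : 0 ≤ sin θ := sin_nonneg_of_nonneg_of_le_pi h.nonneg h.le_pi
    nlinarith
  have hs : 0 < sin θ := sin_pos_of_pos_of_lt_pi h0 (hlt.trans hp)
  have hs' : 0 < sin θ' := sin_pos_of_pos_of_lt_pi (h0.trans hlt) hp
  have key := mul_sin_sub_sin_le_sin_sub h.nonneg hlt.le h'.le_pi
    (abs_le.2 ⟨hm.trans hmm, hm'⟩)
  rw [sin_sub] at key
  have h3 : tan δ * (sin θ * sin θ') = (m - cos θ) * sin θ' := by rw [h1]; ring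
  have h4 : tan δ' * (sin θ * sin θ') = (m' - cos θ') * sin θ := by rw [h2]; ring
  have h5 := mul_lt_mul_of_pos_right htan (mul_pos hs hs')
  have h6 := mul_le_mul_of_nonneg_right hmm hs'.le
  linarith

/-- The phase determines the index. -/
lemma IsPhase.index_unique {N z z' : ℕ} {m θ δ δ' : ℝ} (h : IsPhase N z m θ δ)
    (h' : IsPhase N z' m θ δ') : z = z' := by
  rcases h.nonneg.eq_or_lt with h0 | h0
  · subst h0
    rw [h.index_eq_zero, h'.index_eq_zero]
  rcases h.le_pi.eq_or_lt with hp | hp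
  · subst hp
    rw [h.index_eq_of_pi, h'.index_eq_of_pi]
  have hs : Real.sin θ ≠ 0 := (Real.sin_pos_of_pos_of_lt_pi h0 hp).ne'
  have ht : Real.tan δ = Real.tan δ' := by
    have := h.eq.symm.trans h'.eq
    exact mul_right_cancel₀ hs (add_left_cancel this)
  have hδ : δ = δ' := Real.tan_inj_of_lt_of_lt_pi_div_two (abs_lt.1 h.abs_delta_lt).1
    (abs_lt.1 h.abs_delta_lt).2 (abs_lt.1 h'.abs_delta_lt).1 (abs_lt.1 h'.abs_delta_lt).2 ht
  have := h.angle_eq.symm.trans (hδ ▸ h'.angle_eq)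
  exact_mod_cast mul_right_cancel₀ Real.pi_ne_zero this

open Real in
/-- A solution with `|δ| < π / 2` can be reflected so that its angle lies in `[0, π]`. Outside this
interval only the extreme indices `0` and `N` occur, and there `δ` and `-δ` are both solutions. -/
lemma exists_isPhase_cos_eq {N z : ℕ} (hN : 1 ≤ N) (hz : z ≤ N) {m θ δ : ℝ}
    (hδ : |δ| < π / 2) (hθ : N * θ + 2 * δ = z * π) (hm : m = cos θ + tan δ * sin θ) :
    ∃ θ' δ', IsPhase N z m θ' δ' ∧ cos θ' = cos θ := by
  have hN' : (1 : ℝ) ≤ N := by exact_mod_cast hN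
  have hpi := pi_pos
  have hlt := abs_lt.1 hδ
  by_cases h0 : θ < 0
  · have hz1 : (z : ℝ) < 1 := by nlinarith
    obtain rfl : z = 0 := by
      have : z < 1 := by exact_mod_cast hz1
      omega
    push_cast at hθ
    refine ⟨-θ, -δ, ⟨by linarith, by nlinarith, by rwa [abs_neg], ?_, ?_⟩, cos_neg θ⟩
    · push_cast
      linarith
    · rw [hm, cos_neg, sin_neg, tan_neg]
      ring
  by_cases hp : π < θ
  · have hz1 : (N : ℝ) < z + 1 := by nlinarith
    obtain rfl : z = N := by
      have : N < z + 1 := by exact_mod_cast hz1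
      omega
    refine ⟨2 * π - θ, -δ, ⟨by nlinarith, by linarith, by rwa [abs_neg], by linarith, ?_⟩,
      cos_two_pi_sub θ⟩
    rw [hm, cos_two_pi_sub, sin_two_pi_sub, tan_neg]
    ring
  exact ⟨θ, δ, ⟨not_lt.1 h0, not_lt.1 hp, hδ, hθ, hm⟩, rfl⟩

open Real in
/-- For a fixed boundary parameter, different indices have different frequencies. -/
lemma cos_ne_cos_of_index_ne {N z z' : ℕ} (hN : 1 ≤ N) (hz : z ≤ N) (hz' : z' ≤ N)
    {m θ δ θ' δ' : ℝ}
    (hδ : |δ| < π / 2) (hθ : N * θ + 2 * δ = z * π) (hm : m = cos θ + tan δ * sin θ)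
    (hδ' : |δ'| < π / 2) (hθ' : N * θ' + 2 * δ' = z' * π) (hm' : m = cos θ' + tan δ' * sin θ')
    (hne : z ≠ z') : cos θ ≠ cos θ' := by
  obtain ⟨a, b, h, hc⟩ := exists_isPhase_cos_eq hN hz hδ hθ hm
  obtain ⟨a', b', h', hc'⟩ := exists_isPhase_cos_eq hN hz' hδ' hθ' hm'
  intro heq
  have haa : a = a' := injOn_cos ⟨h.nonneg, h.le_pi⟩ ⟨h'.nonneg, h'.le_pi⟩ (by rw [hc, hc', heq])
  subst haa
  exact hne (h.index_unique h')

open Real Filter Topology in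
/-- The intermediate value theorem in the variable `t = tan (θ / 2)`, in which
`(m - cos θ) / sin θ = ((1 + m) t - (1 - m) t⁻¹) / 2`. The phase `N θ + 2 δ` runs from `-π` to
`(N + 1) π`. -/
lemma exists_isPhase_of_mem_Ioo {N z : ℕ} (hz : z ≤ N) {m : ℝ} (h1 : -1 < m)
    (h2 : m < 1) : ∃ θ δ, IsPhase N z m θ δ := by
  set u : ℝ → ℝ := fun t => (1 + m) / 2 * t - (1 - m) / 2 * t⁻¹ with hu
  set Φ : ℝ → ℝ := fun t => N * (2 * arctan t) + 2 * arctan (u t) with hΦ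
  have hcont : ContinuousOn Φ (Set.Ioi 0) := by
    have : ContinuousOn u (Set.Ioi 0) := by
      have h0 : ContinuousOn (fun t : ℝ => t⁻¹) (Set.Ioi 0) :=
        continuousOn_inv₀.mono fun t (ht : 0 < t) => ht.ne'
      fun_prop
    have h3 : ContinuousOn (fun t => arctan (u t)) (Set.Ioi 0) :=
      continuous_arctan.comp_continuousOn this
    have h4 := continuous_arctan
    fun_prop
  have hinv : Tendsto (fun t : ℝ => (1 - m) / 2 * t⁻¹) (𝓝[>] 0) atTop :=
    tendsto_inv_nhdsGT_zero.const_mul_atTop (by linarith)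
  have hid : Tendsto (fun t : ℝ => t) (𝓝[>] 0) (𝓝 0) := tendsto_id'.2 nhdsWithin_le_nhds
  have hu0 : Tendsto u (𝓝[>] 0) atBot := by
    have := (hid.const_mul ((1 + m) / 2)).add_atBot (tendsto_neg_atTop_atBot.comp hinv)
    exact this.congr fun t => by simp [hu, sub_eq_add_neg]
  have huT : Tendsto u atTop atTop := by
    have h3 : Tendsto (fun t : ℝ => (1 + m) / 2 * t) atTop atTop :=
      tendsto_id.const_mul_atTop (by linarith)
    have h4 : Tendsto (fun t : ℝ => -((1 - m) / 2 * t⁻¹)) atTop (𝓝 (-((1 - m) / 2 * 0))) :=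
      (tendsto_inv_atTop_zero.const_mul _).neg
    exact (h3.atTop_add h4).congr fun t => by simp [hu, sub_eq_add_neg]
  have hl : Tendsto Φ (𝓝[>] 0) (𝓝 (N * (2 * arctan 0) + 2 * (-(π / 2)))) :=
    ((((continuous_arctan.tendsto 0).comp hid).const_mul 2).const_mul (N : ℝ)).add
      (((tendsto_nhds_of_tendsto_nhdsWithin tendsto_arctan_atBot).comp hu0).const_mul 2)
  have hr : Tendsto Φ atTop (𝓝 (N * (2 * (π / 2)) + 2 * (π / 2))) :=
    ((((tendsto_nhds_of_tendsto_nhdsWithin tendsto_arctan_atTop)).const_mul 2).const_mul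
      (N : ℝ)).add
      (((tendsto_nhds_of_tendsto_nhdsWithin tendsto_arctan_atTop).comp huT).const_mul 2)
  have hzN : (z : ℝ) ≤ N := by exact_mod_cast hz
  have hz0 : (0 : ℝ) ≤ z := z.cast_nonneg
  obtain ⟨t, ht, hΦt⟩ := isPreconnected_Ioi.intermediate_value_Ioo
    (l₁ := 𝓝[>] 0) (l₂ := atTop) inf_le_right (le_principal_iff.2 (Ioi_mem_atTop 0)) hcont hl hr
    (show (z : ℝ) * π ∈ _ from ⟨by rw [arctan_zero]; nlinarith [pi_pos], by nlinarith [pi_pos]⟩)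
  have ht : 0 < t := ht
  refine ⟨2 * arctan t, arctan (u t), ⟨?_, ?_, ?_, hΦt, ?_⟩⟩
  · have := arctan_pos.2 ht
    linarith
  · linarith [arctan_lt_pi_div_two t]
  · exact abs_lt.2 ⟨neg_pi_div_two_lt_arctan _, arctan_lt_pi_div_two _⟩
  · have hc := cos_sq_arctan t
    have hs : sin (arctan t) = t * cos (arctan t) := by
      rw [sin_arctan, cos_arctan]; ring
    rw [tan_arctan, cos_two_mul, sin_two_mul, hs,
      show 2 * (t * cos (arctan t)) * cos (arctan t) = 2 * t * cos (arctan t) ^ 2 by ring, hc]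
    simp only [hu]
    field_simp
    ring

open Real in
lemma exists_isPhase {N z : ℕ} (hN : 1 ≤ N) (hz : z ≤ N) {m : ℝ} (h1 : -1 ≤ m)
    (h2 : m ≤ 1) : ∃ θ δ, IsPhase N z m θ δ := by
  have hzN : (z : ℝ) ≤ N := by exact_mod_cast hz
  have hz0 : (0 : ℝ) ≤ z := z.cast_nonneg
  have hN' : (1 : ℝ) ≤ N := by exact_mod_cast hN
  have hpi := pi_pos
  rcases h1.eq_or_lt with rfl | h1
  · -- at `m = -1` the equation reads `δ = (θ - π) / 2`
    set α : ℝ := (N - z) / (N + 1) * (π / 2) with hα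
    have h01 : (N - z : ℝ) / (N + 1) < 1 := by rw [div_lt_one (by linarith)]; linarith
    have h00 : 0 ≤ (N - z : ℝ) / (N + 1) := div_nonneg (by linarith) (by linarith)
    have hα0 : 0 ≤ α := by positivity
    have hα1 : α < π / 2 := by rw [hα]; nlinarith
    have hc : cos α ≠ 0 := (cos_pos_of_mem_Ioo ⟨by linarith, hα1⟩).ne'
    refine ⟨π - 2 * α, -α, ⟨by linarith, by linarith, ?_, ?_, ?_⟩⟩
    · rwa [abs_neg, abs_of_nonneg hα0]
    · rw [hα]; field_simp; ring
    · rw [cos_pi_sub, sin_pi_sub, tan_neg, sin_two_mul, cos_two_mul, tan_eq_sin_div_cos]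
      field_simp
      linear_combination 2 * sin_sq_add_cos_sq α
  rcases h2.eq_or_lt with rfl | h2
  · -- at `m = 1` the equation reads `δ = θ / 2`
    set α : ℝ := z / (N + 1) * (π / 2) with hα
    have h01 : (z : ℝ) / (N + 1) < 1 := by rw [div_lt_one (by linarith)]; linarith
    have hα0 : 0 ≤ α := by positivity
    have hα1 : α < π / 2 := by rw [hα]; nlinarith
    have hc : cos α ≠ 0 := (cos_pos_of_mem_Ioo ⟨by linarith, hα1⟩).ne'
    refine ⟨2 * α, α, ⟨by linarith, by linarith, ?_, ?_, ?_⟩⟩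
    · rwa [abs_of_nonneg hα0]
    · rw [hα]; field_simp
    · rw [sin_two_mul, cos_two_mul, tan_eq_sin_div_cos]
      field_simp
      linear_combination -2 * sin_sq_add_cos_sq α
  exact exists_isPhase_of_mem_Ioo hz h1 h2

open Real in
/-- The boundary parameter and the index determine the frequency. -/
lemma cos_eq_of_index_eq {N z : ℕ} (hN : 1 ≤ N) (hz : z ≤ N) {m θ δ θ' δ' : ℝ} (h1 : -1 ≤ m)
    (h2 : m ≤ 1)
    (hδ : |δ| < π / 2) (hθ : N * θ + 2 * δ = z * π) (hm : m = cos θ + tan δ * sin θ)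
    (hδ' : |δ'| < π / 2) (hθ' : N * θ' + 2 * δ' = z * π) (hm' : m = cos θ' + tan δ' * sin θ') :
    cos θ = cos θ' := by
  obtain ⟨a, b, h, hc⟩ := exists_isPhase_cos_eq hN hz hδ hθ hm
  obtain ⟨a', b', h', hc'⟩ := exists_isPhase_cos_eq hN hz hδ' hθ' hm'
  rw [← hc, ← hc', (h.antitone hN h' h2 h1 le_rfl).antisymm (h'.antitone hN h h2 h1 le_rfl)]

/-- The average frequency is a monotone self-map of `[-1, 1]` as a function of the boundary
parameter, and so has a fixed point. -/
lemma exists_isPhase_average_eq {d : ℕ} (hd : 0 < d) {N z : Fin d → ℕ} (hN : ∀ j, 1 ≤ N j)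
    (hz : ∀ j, z j ≤ N j) : ∃ (m : ℝ) (θ δ : Fin d → ℝ),
      (∀ j, IsPhase (N j) (z j) m (θ j) (δ j)) ∧ d * m = ∑ j, Real.cos (θ j) := by
  have hex : ∀ (m : Set.Icc (-1 : ℝ) 1) (j : Fin d), ∃ θ δ, IsPhase (N j) (z j) m θ δ :=
    fun m j => exists_isPhase (hN j) (hz j) m.2.1 m.2.2
  choose θ δ hsol using hex
  have hd' : (0 : ℝ) < d := by exact_mod_cast hd
  let avg (m : Set.Icc (-1 : ℝ) 1) : ℝ := (∑ j, Real.cos (θ m j)) / d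
  have havg : ∀ m, avg m ∈ Set.Icc (-1 : ℝ) 1 := by
    intro m
    constructor
    · rw [le_div_iff₀ hd']
      calc -1 * (d : ℝ) = ∑ _j : Fin d, (-1 : ℝ) := by simp
        _ ≤ _ := Finset.sum_le_sum fun j _ => Real.neg_one_le_cos _
    · rw [div_le_iff₀ hd']
      calc _ ≤ ∑ _j : Fin d, (1 : ℝ) := Finset.sum_le_sum fun j _ => Real.cos_le_one _
        _ = 1 * (d : ℝ) := by simp
  have hmono : Monotone avg := by
    intro a b hab
    refine div_le_div_of_nonneg_right (Finset.sum_le_sum fun j _ => ?_) hd'.le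
    exact Real.cos_le_cos_of_nonneg_of_le_pi (hsol b j).nonneg (hsol a j).le_pi
      ((hsol a j).antitone (hN j) (hsol b j) b.2.2 a.2.1 hab)
  have : Fact ((-1 : ℝ) ≤ 1) := ⟨by norm_num⟩
  let f : Set.Icc (-1 : ℝ) 1 →o Set.Icc (-1 : ℝ) 1 :=
    ⟨fun m => ⟨avg m, havg m⟩, fun _ _ h => hmono h⟩
  have hfix : f f.lfp = f.lfp := f.map_lfp
  refine ⟨f.lfp, θ f.lfp, δ f.lfp, hsol _, ?_⟩
  have h : avg f.lfp = f.lfp := congrArg Subtype.val hfix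
  rw [← h]
  exact mul_div_cancel₀ _ hd'.ne'

/-! ### Eigenvectors of the grid -/

section
variable {d : ℕ} {n : Fin d → ℕ}

/-- The one-dimensional factor of the eigenvectors in dimension `j`. -/
noncomputable def gridFactor (n : Fin d → ℕ) (z : GridNode n) (δ : Fin d → ℝ) (j : Fin d)
    (a : Fin (n j)) : ℝ :=
  (-1 : ℝ) ^ ((a : ℕ) + 1) * Real.cos ((a : ℕ) * gridAngle n z δ j + δ j)

lemma gridEigenvector_eq (n : Fin d → ℕ) (z : GridNode n) (δ : Fin d → ℝ) :
    gridEigenvector n z δ =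
      fun x => √((gridGraph n).degree x : ℝ) * ∏ j, gridFactor n z δ j (x j) := by
  ext x
  simp only [gridEigenvector, gridFactor, gridAngle, one_mul, div_eq_mul_inv, mul_assoc]

lemma mul_gridAngle (hn : ∀ j, 2 ≤ n j) (z : GridNode n) (δ : Fin d → ℝ) (j : Fin d) :
    ((n j : ℝ) - 1) * gridAngle n z δ j + 2 * δ j = (z j : ℕ) * Real.pi := by
  have h : (2 : ℝ) ≤ n j := by exact_mod_cast hn j
  have h' : (n j : ℝ) - 1 ≠ 0 := by linarith
  unfold gridAngle
  field_simp
  ring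

lemma IsShiftSolution.cos_sub {z : GridNode n} {lam : ℝ} {δ : Fin d → ℝ}
    (h : IsShiftSolution n z lam δ) (j : Fin d) :
    Real.cos (gridAngle n z δ j - δ j) = (lam - 1) * Real.cos (δ j) := by
  have hc := h.cos_ne_zero j
  rw [h.eq_at j, Real.tan_eq_sin_div_cos, Real.cos_sub]
  field_simp
  ring

lemma IsShiftSolution.sum_cos {z : GridNode n} {lam : ℝ} {δ : Fin d → ℝ}
    (h : IsShiftSolution n z lam δ) : ∑ j, Real.cos (gridAngle n z δ j) = d * (lam - 1) := by
  have := h.sum_eq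
  rw [Finset.sum_add_distrib, ← Finset.mul_sum] at this
  simp only [Finset.sum_const, Finset.card_univ, Fintype.card_fin, nsmul_eq_mul] at this
  linarith

lemma IsShiftSolution.mem_Icc (hd : 0 < d) {z : GridNode n} {lam : ℝ} {δ : Fin d → ℝ}
    (h : IsShiftSolution n z lam δ) : lam - 1 ∈ Set.Icc (-1 : ℝ) 1 := by
  have hd' : (0 : ℝ) < d := by exact_mod_cast hd
  have hsum := h.sum_cos
  have h1 : ∑ j, Real.cos (gridAngle n z δ j) ≤ ∑ _j : Fin d, (1 : ℝ) :=
    Finset.sum_le_sum fun j _ => Real.cos_le_one _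
  have h2 : ∑ _j : Fin d, (-1 : ℝ) ≤ ∑ j, Real.cos (gridAngle n z δ j) :=
    Finset.sum_le_sum fun j _ => Real.neg_one_le_cos _
  simp only [Finset.sum_const, Finset.card_univ, Fintype.card_fin, nsmul_eq_mul, hsum] at h1 h2
  exact ⟨le_of_mul_le_mul_left h2 hd', le_of_mul_le_mul_left h1 hd'⟩

lemma IsShiftSolution.eq_gridEigenvalue (hd : 0 < d) {z : GridNode n} {lam : ℝ} {δ : Fin d → ℝ}
    (h : IsShiftSolution n z lam δ) : lam = gridEigenvalue n z δ := by
  have hd' : (d : ℝ) ≠ 0 := by exact_mod_cast hd.ne'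
  rw [gridEigenvalue, h.sum_cos]
  field_simp
  ring

/-- The product of the factors is an eigenfunction of the random walk on the grid: the neighbour
sums along the lines leave the boundary terms `(lam - 1) * (2 - deg)`, whose total
`(lam - 1) * (2 * d - deg)` combines with the sum equation. -/
lemma IsShiftSolution.neighbor_sum (hn : ∀ j, 2 ≤ n j) {z : GridNode n} {lam : ℝ} {δ : Fin d → ℝ}
    (h : IsShiftSolution n z lam δ) (x : GridNode n) :
    (∑ y, if (gridGraph n).Adj x y then ∏ j, gridFactor n z δ j (y j) else 0) =
      (1 - lam) * (gridGraph n).degree x * ∏ j, gridFactor n z δ j (x j) := by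
  classical
  rw [sum_gridGraph_adj n x fun y => ∏ j, gridFactor n z δ j (y j)]
  have hline : ∀ j, (pathSum (x j) fun a =>
      ∏ i, gridFactor n z δ i (Function.update x j a i)) =
      (-2 * Real.cos (gridAngle n z δ j) + (lam - 1) * (2 - pathDegree (x j))) *
        ∏ i, gridFactor n z δ i (x i) := by
    intro j
    have hprod : ∀ a, ∏ i, gridFactor n z δ i (Function.update x j a i) =
        gridFactor n z δ j a * ∏ i ∈ Finset.univ.erase j, gridFactor n z δ i (x i) := by
      intro a
      rw [← Finset.mul_prod_erase _ _ (Finset.mem_univ j), Function.update_self]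
      congr 1
      refine Finset.prod_congr rfl fun i hi => ?_
      rw [Function.update_of_ne (Finset.ne_of_mem_erase hi)]
    have hw := pathSum_wave (x j) (mul_gridAngle hn z δ j) (h.cos_sub j)
    rw [← Finset.mul_prod_erase _ _ (Finset.mem_univ j), ← mul_assoc]
    change _ = _ * ((-1 : ℝ) ^ ((x j : ℕ) + 1) *
      Real.cos ((x j : ℕ) * gridAngle n z δ j + δ j)) * _
    rw [← hw]
    simp only [hprod, pathSum, Finset.sum_mul, ite_mul, zero_mul]
    rfl
  simp only [hline]
  rw [← Finset.sum_mul, gridGraph_degree]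
  congr 1
  rw [Finset.sum_add_distrib, ← Finset.mul_sum, ← Finset.mul_sum, Finset.sum_sub_distrib, h.sum_cos]
  simp only [Finset.sum_const, Finset.card_univ, Fintype.card_fin, nsmul_eq_mul]
  ring

lemma gridEigenvector_ne_zero (hd : 0 < d) (hn : ∀ j, 2 ≤ n j) {z : GridNode n}
    {lam : ℝ} {δ : Fin d → ℝ} (h : IsShiftSolution n z lam δ) : gridEigenvector n z δ ≠ 0 := by
  intro h0
  -- at the corner with all coordinates `0` the product is `∏ j, -cos (δ j)`
  have hx := congrFun h0 fun j => ⟨0, by have := hn j; omega⟩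
  rw [gridEigenvector_eq, Pi.zero_apply, mul_eq_zero] at hx
  rcases hx with hx | hx
  · exact (Real.sqrt_pos.2 (gridGraph_degree_pos hd hn _)).ne' hx
  · obtain ⟨j, -, hj⟩ := Finset.prod_eq_zero_iff.1 hx
    simp [gridFactor, h.cos_ne_zero j] at hj

open scoped Matrix in
lemma IsShiftSolution.mulVec_eq (hd : 0 < d) (hn : ∀ j, 2 ≤ n j) {z : GridNode n}
    {lam : ℝ} {δ : Fin d → ℝ} (h : IsShiftSolution n z lam δ) :
    normalizedLaplacian (gridGraph n) *ᵥ gridEigenvector n z δ = lam • gridEigenvector n z δ := by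
  rw [gridEigenvector_eq]
  exact normalizedLaplacian_mulVec _ (gridGraph_degree_pos hd hn) (h.neighbor_sum hn)

lemma IsShiftSolution.hasEigenvector (hd : 0 < d) (hn : ∀ j, 2 ≤ n j) {z : GridNode n}
    {lam : ℝ} {δ : Fin d → ℝ} (h : IsShiftSolution n z lam δ) :
    Module.End.HasEigenvector (Matrix.toLin' (normalizedLaplacian (gridGraph n)))
      (gridEigenvalue n z δ) (gridEigenvector n z δ) := by
  refine ⟨Module.End.mem_eigenspace_iff.2 ?_, gridEigenvector_ne_zero hd hn h⟩
  rw [Matrix.toLin'_apply, ← h.eq_gridEigenvalue hd, h.mulVec_eq hd hn]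

/-- The degree is the sum of the path degrees, so the inner product of two eigenvectors is a sum of
products of one-dimensional inner products, one of which carries the path degree as weight. -/
lemma dotProduct_gridEigenvector (z z' : GridNode n) (δ δ' : Fin d → ℝ) :
    gridEigenvector n z δ ⬝ᵥ gridEigenvector n z' δ' =
      ∑ j, ∏ i, ∑ a, (if i = j then pathDegree a else 1) *
        (gridFactor n z δ i a * gridFactor n z' δ' i a) := by
  classical
  rw [gridEigenvector_eq, gridEigenvector_eq]
  simp only [dotProduct, Finset.prod_univ_sum, Fintype.piFinset_univ]
  rw [Finset.sum_comm]
  refine Finset.sum_congr rfl fun x _ => ?_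
  have hs := Real.mul_self_sqrt (Nat.cast_nonneg (α := ℝ) ((gridGraph n).degree x))
  have hprod : ∀ j, ∏ i, ((if i = j then pathDegree (x i) else 1) *
      (gridFactor n z δ i (x i) * gridFactor n z' δ' i (x i))) =
      pathDegree (x j) * ∏ i, (gridFactor n z δ i (x i) * gridFactor n z' δ' i (x i)) := by
    intro j
    rw [Finset.prod_mul_distrib, Finset.prod_ite_eq' Finset.univ j]
    simp
  simp only [hprod]
  rw [← Finset.sum_mul, ← gridGraph_degree, ← hs, Finset.prod_mul_distrib, hs]
  linear_combination (∏ i, gridFactor n z δ i (x i)) * (∏ i, gridFactor n z' δ' i (x i)) * hs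

open scoped Matrix in
/-- Eigenvectors for different eigenvalues are orthogonal because the matrix is symmetric. For
equal eigenvalues the factors are orthogonal in every dimension where the indices differ, and the
sum equation makes the indices differ in at least two dimensions. -/
lemma IsShiftSolution.dotProduct_eq_zero (hd : 0 < d) (hn : ∀ j, 2 ≤ n j) {z z' : GridNode n}
    {lam lam' : ℝ} {δ δ' : Fin d → ℝ} (h : IsShiftSolution n z lam δ)
    (h' : IsShiftSolution n z' lam' δ') (hδ : ∀ j, |δ j| < Real.pi / 2)
    (hδ' : ∀ j, |δ' j| < Real.pi / 2) (hne : z ≠ z') :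
    gridEigenvector n z δ ⬝ᵥ gridEigenvector n z' δ' = 0 := by
  by_cases hlam : lam = lam'
  swap
  · exact dotProduct_eq_zero_of_eigenvalue_ne (normalizedLaplacian_isSymm _)
      (h.mulVec_eq hd hn) (h'.mulVec_eq hd hn) hlam
  subst hlam
  have hN : ∀ j, 1 ≤ n j - 1 := fun j => by have := hn j; omega
  have hcast : ∀ j, ((n j - 1 : ℕ) : ℝ) = (n j : ℝ) - 1 := fun j => by
    rw [Nat.cast_sub (by have := hn j; omega), Nat.cast_one]
  have hz : ∀ (w : GridNode n) j, (w j : ℕ) ≤ n j - 1 := fun w j => by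
    have := (w j).isLt
    omega
  have hangle : ∀ (w : GridNode n) (ε : Fin d → ℝ) j,
      ((n j - 1 : ℕ) : ℝ) * gridAngle n w ε j + 2 * ε j = (w j : ℕ) * Real.pi := fun w ε j => by
    rw [hcast, mul_gridAngle hn]
  have heq : ∀ {w : GridNode n} {ε : Fin d → ℝ}, IsShiftSolution n w lam ε → ∀ j,
      lam - 1 = Real.cos (gridAngle n w ε j) +
        Real.tan (ε j) * Real.sin (gridAngle n w ε j) := fun hw j => by
    rw [hw.eq_at j]
    ring
  have hcos_ne : ∀ j, z j ≠ z' j →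
      Real.cos (gridAngle n z δ j) ≠ Real.cos (gridAngle n z' δ' j) := fun j hj =>
    cos_ne_cos_of_index_ne (hN j) (hz z j) (hz z' j) (hδ j) (hangle z δ j) (heq h j) (hδ' j)
      (hangle z' δ' j) (heq h' j) fun e => hj (Fin.ext e)
  have hlam := h.mem_Icc hd
  have hcos_eq : ∀ j, z j = z' j →
      Real.cos (gridAngle n z δ j) = Real.cos (gridAngle n z' δ' j) := fun j hj =>
    cos_eq_of_index_eq (hN j) (hz z j) hlam.1 hlam.2 (hδ j) (hangle z δ j) (heq h j) (hδ' j)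
      (by rw [hangle z' δ' j, hj]) (heq h' j)
  have horth : ∀ j, z j ≠ z' j →
      ∑ a, gridFactor n z δ j a * gridFactor n z' δ' j a = 0 := fun j hj =>
    sum_wave_mul_wave (mul_gridAngle hn z δ j) (h.cos_sub j) (mul_gridAngle hn z' δ' j)
      (h'.cos_sub j) (hcos_ne j hj)
  obtain ⟨j, hj⟩ := Function.ne_iff.1 hne
  obtain ⟨i, hij, hi⟩ : ∃ i, i ≠ j ∧ z i ≠ z' i := by
    by_contra! hall
    refine hcos_ne j hj ?_
    have hsum := h.sum_cos.trans h'.sum_cos.symm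
    rw [← Finset.add_sum_erase _ _ (Finset.mem_univ j),
      ← Finset.add_sum_erase Finset.univ (fun j => Real.cos (gridAngle n z' δ' j))
        (Finset.mem_univ j),
      Finset.sum_congr rfl fun i hi => hcos_eq i (hall i (Finset.ne_of_mem_erase hi))] at hsum
    exact add_right_cancel hsum
  rw [dotProduct_gridEigenvector]
  refine Finset.sum_eq_zero fun k _ => ?_
  -- one of the two dimensions `i`, `j` differs from the dimension `k` that carries the weight
  obtain ⟨l, hlk, hl⟩ : ∃ l, l ≠ k ∧ z l ≠ z' l := by
    by_cases hjk : j = k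
    · exact ⟨i, hjk ▸ hij, hi⟩
    · exact ⟨j, hjk, hj⟩
  refine Finset.prod_eq_zero (Finset.mem_univ l) ?_
  simpa only [if_neg hlk, one_mul] using horth l hl

lemma exists_isShiftSolution (hd : 0 < d) (hn : ∀ j, 2 ≤ n j) (z : GridNode n) :
    ∃ (lam : ℝ) (δ : Fin d → ℝ), IsShiftSolution n z lam δ ∧ ∀ j, |δ j| < Real.pi / 2 := by
  obtain ⟨m, θ, δ, h, hm⟩ := exists_isPhase_average_eq hd (N := fun j => n j - 1)
    (z := fun j => (z j : ℕ)) (fun j => by have := hn j; omega)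
    (fun j => by have := (z j).isLt; omega)
  have hangle : ∀ j, gridAngle n z δ j = θ j := by
    intro j
    have h1 := (h j).angle_eq
    rw [Nat.cast_sub (by have := hn j; omega), Nat.cast_one, ← mul_gridAngle hn z δ j] at h1
    have h2 : (2 : ℝ) ≤ n j := by exact_mod_cast hn j
    exact (mul_left_cancel₀ (by linarith) (add_right_cancel h1)).symm
  refine ⟨1 + m, δ, ⟨?_, fun j => ?_, fun j => ?_⟩, fun j => (h j).abs_delta_lt⟩
  · simp only [hangle, Finset.sum_add_distrib, ← Finset.mul_sum, ← hm, Finset.sum_const,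
      Finset.card_univ, Fintype.card_fin, nsmul_eq_mul]
    ring
  · have := abs_lt.1 (h j).abs_delta_lt
    exact (Real.cos_pos_of_mem_Ioo ⟨by linarith, this.2⟩).ne'
  · rw [hangle, add_assoc, ← (h j).eq]

end

theorem mainTheorem7 {d : ℕ} (n : Fin d → ℕ) (hn : ∀ j, 2 ≤ n j)
    (hinner : ¬ ∃ x : GridNode n, IsInnerNode n x) :
    -- for every index the system is solvable, with shifts in `(-π/2, π/2)`
    (∀ z : GridNode n, ∃ (lam : ℝ) (δ : Fin d → ℝ), IsShiftSolution n z lam δ ∧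
      ∀ j, |δ j| < Real.pi / 2) ∧
    -- every solution of the system, whatever the range of its shifts, gives an eigenpair
    (∀ (z : GridNode n) (lam : ℝ) (δ : Fin d → ℝ), IsShiftSolution n z lam δ →
      lam = gridEigenvalue n z δ ∧
      Module.End.HasEigenvector (Matrix.toLin' (normalizedLaplacian (gridGraph n)))
        (gridEigenvalue n z δ) (gridEigenvector n z δ)) ∧
    -- any choice of solutions with shifts in `(-π/2, π/2)` gives all eigenvalues and eigenvectors
    (∀ (lam : GridNode n → ℝ) (δ : GridNode n → Fin d → ℝ),
      (∀ z, IsShiftSolution n z (lam z) (δ z) ∧ ∀ j, |δ z j| < Real.pi / 2) →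
      (∀ z z' : GridNode n, z ≠ z' →
        gridEigenvector n z (δ z) ⬝ᵥ gridEigenvector n z' (δ z') = 0) ∧
      Submodule.span ℝ (Set.range fun z => gridEigenvector n z (δ z)) = ⊤ ∧
      ∀ t : ℝ, Module.End.HasEigenvalue
          (Matrix.toLin' (normalizedLaplacian (gridGraph n))) t ↔
        ∃ z, t = gridEigenvalue n z (δ z)) := by
  -- a grid of dimension `0` has an inner node, for want of dimensions
  have hd : 0 < d := by
    rw [Nat.pos_iff_ne_zero]
    rintro rfl
    exact hinner ⟨fun j => j.elim0, fun j => j.elim0⟩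
  refine ⟨exists_isShiftSolution hd hn, fun z lam δ h =>
    ⟨h.eq_gridEigenvalue hd, h.hasEigenvector hd hn⟩, fun lam δ h => ?_⟩
  have horth : ∀ z z' : GridNode n, z ≠ z' →
      gridEigenvector n z (δ z) ⬝ᵥ gridEigenvector n z' (δ z') = 0 := fun z z' hne =>
    (h z).1.dotProduct_eq_zero hd hn (h z').1 (h z).2 (h z').2 hne
  have hspan := span_eq_top_of_pairwise_dotProduct_eq_zero
    (v := fun z => gridEigenvector n z (δ z)) (fun z => gridEigenvector_ne_zero hd hn (h z).1) horth
  exact ⟨horth, hspan, hasEigenvalue_iff_of_span_eigenvectors_eq_top (normalizedLaplacian_isSymm _)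
    (fun z => (h z).1.hasEigenvector hd hn) hspan⟩
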